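/- Fix an integer $k \ge 0$. Let $\mathcal{L}$ be the set of line segments joining consecutive integral points on the lines in $\mathbb{R}^2$ of slope $0$, $-1$ or $\infty$ through integral points. For coprime integers $p,q\ge 0$ let $\gamma$ be the straight segment oriented from $(0,0)$ to $(p,q)$, and let $\tau_1,\dots,\tau_N$ be the segments of $\mathcal{L}$ whose interiors $\gamma$ crosses transversally in an interior point of $\gamma$, in the order in which they are crossed. Let $\mathcal{P}_{(p,q)}$ be the poset on the elements $(\tau_j,i)$, $1\le j\le N$, $0\le i\le k$, whose order is generated by the following relations: $(\tau_j,0)\succ(\tau_j,1)\succ\dots\succ(\tau_j,k)$ if the crossing point is strictly closer to the endpoint of $\tau_j$ lying to the right of $\gamma$ than to the other endpoint, and $(\tau_j,0)\prec(\tau_j,1)\prec\dots\prec(\tau_j,k)$ otherwise; $(\tau_j,k)\succ(\tau_{j+1},0)$ if the common endpoint of $\tau_j$ and $\tau_{j+1}$ lies to the right of $\gamma$, and $(\tau_j,k)\prec(\tau_{j+1},0)$ if it lies to the left. Let $m^{(k)}_{q/p}$ be the number of order ideals (downward closed subsets, including $\emptyset$) of $\mathcal{P}_{(p,q)}$. For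 sequences, $a_n\sim b_n$ means $\lim_{n\to\infty} a_n/b_n=1$. **Proposition 4.1.** Let $k\ge 0$ be an integer. (1) The sequence $f_n := m^{(k)}_{1/n}$, $n \ge 0$ (where the label $1/0$ stands for $(p,q)=(0,1)$), satisfies $f_0=1$, $f_1=k+2$ and, for all $n\ge 2$, $$f_n=(2k+3)f_{n-1}-f_{n-2}-k.$$ With $\alpha := 4k^2+12k+5$, for all $n \ge 0$, $$f_n=\frac{k}{1+2k}+\frac{2k^2+3k+1+(1+k)\sqrt{\alpha}}{2(1+2k)\sqrt{\alpha}}\left(\frac{3+2k+\sqrt{\alpha}}{2}\right)^n+\frac{-(2k^2+3k+1)+(1+k)\sqrt{\alpha}}{2(1+2k)\sqrt{\alpha}}\left(\frac{3+2k-\sqrt{\alpha}}{2}\right)^n,$$ and $$f_n\sim\frac{2k^2+3k+1+(1+k)\sqrt{\alpha}}{2(1+2k)\sqrt{\alpha}}\left(\frac{3+2k+\sqrt{\alpha}}{2}\right)^n.$$ (2) The sequence $g_n := m^{(k)}_{n/(n+1)}$, $n\ge 0$, satisfies $g_0=1$, $g_1=2k^2+6k+5$ and, for all $n\ge 2$,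 $$g_n=(3k^2+8k+6)g_{n-1}-g_{n-2}-k(k+2).$$ With $\beta := 3k^2+8k+6$ and $\delta := 3k^4+17k^3+34k^2+28k+8$, for all $n \ge 0$, $$g_n=\frac{k}{3k+2}+\frac{(k+1)(k+2)(\beta^2-4)+\delta\sqrt{\beta^2-4}}{(\beta-2)(\beta^2-4)}\left(\frac{\beta+\sqrt{\beta^2-4}}{2}\right)^n+\frac{(k+1)(k+2)(\beta^2-4)-\delta\sqrt{\beta^2-4}}{(\beta-2)(\beta^2-4)}\left(\frac{\beta-\sqrt{\beta^2-4}}{2}\right)^n,$$ and $$g_n\sim\frac{(k+1)(k+2)(\beta^2-4)+\delta\sqrt{\beta^2-4}}{(\beta-2)(\beta^2-4)}\left(\frac{\beta+\sqrt{\beta^2-4}}{2}\right)^n.$$ -/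

import Mathlib

open Filter Topology

namespace KMarkov

/-- The three directions (slopes `0`, `∞`, `-1`) of the lines of the lattice `𝓛`. -/
inductive Dir
  | horizontal
  | vertical
  | antidiagonal

/-- The vector from one integral point to the next one on a line of the given direction. -/
def Dir.vec : Dir → ℤ × ℤ
  | .horizontal => (1, 0)
  | .vertical => (0, 1)
  | .antidiagonal => (1, -1)

/-- A line segment of `𝓛`: it joins two consecutive integral points of a line of slope
`0`, `∞` or `-1` through integral points. Each such segment is represented exactly once. -/
structure LatticeSegment where
  /-- the first endpoint -/
  src : ℤ × ℤ
  /-- the direction -/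
  dir : Dir

/-- The second endpoint of a segment of `𝓛`. -/
def LatticeSegment.tgt (τ : LatticeSegment) : ℤ × ℤ := τ.src + τ.dir.vec

/-- `P` is one of the two endpoints of `τ`. -/
def LatticeSegment.IsEndpoint (τ : LatticeSegment) (P : ℤ × ℤ) : Prop :=
  P = τ.src ∨ P = τ.tgt

/-- The determinant of two vectors of `ℤ²`. -/
def det (u v : ℤ × ℤ) : ℤ := u.1 * v.2 - u.2 * v.1

/-- `P` lies to the right of the straight line from the origin to `(p, q)`. -/
def RightOf (p q : ℤ) (P : ℤ × ℤ) : Prop := det (p, q) P < 0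

/-- `P` lies to the left of the straight line from the origin to `(p, q)`. -/
def LeftOf (p q : ℤ) (P : ℤ × ℤ) : Prop := 0 < det (p, q) P

/-- A crossing of the oriented straight segment `γ` from `(0, 0)` to `(p, q)` with a line
segment of `𝓛`: the point `t • (p, q)` of `γ` is the point `src + s • (tgt - src)` of the
segment, it is interior to both, and the two are not parallel. The numbers `t` and `s` are
determined by the segment, so crossings correspond to the segments of `𝓛` crossed by `γ`. -/
structure Crossing (p q : ℤ) where
  /-- the segment of `𝓛` that is crossed -/
  seg : LatticeSegment
  /-- the position of the crossing along `γ` -/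
  t : ℝ
  /-- the position of the crossing along `seg` -/
  s : ℝ
  t_pos : 0 < t
  t_lt_one : t < 1
  s_pos : 0 < s
  s_lt_one : s < 1
  transversal : det (p, q) seg.dir.vec ≠ 0
  eq_fst : t * (p : ℝ) = (seg.src.1 : ℝ) + s * (seg.dir.vec.1 : ℝ)
  eq_snd : t * (q : ℝ) = (seg.src.2 : ℝ) + s * (seg.dir.vec.2 : ℝ)

/-- The crossing lies strictly closer to the endpoint of the crossed segment that lies to the
right of `γ` than to the other endpoint. -/
def Crossing.CloserToRight {p q : ℤ} (c : Crossing p q) : Prop :=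
  (RightOf p q c.seg.src ∧ c.s < 1 - c.s) ∨ (RightOf p q c.seg.tgt ∧ 1 - c.s < c.s)

/-- `γ` crosses `c` and then `c'`, with no crossing in between. -/
def Crossing.Consecutive {p q : ℤ} (c c' : Crossing p q) : Prop :=
  c.t < c'.t ∧ ∀ d : Crossing p q, ¬ (c.t < d.t ∧ d.t < c'.t)

/-- The elements `(τ, i)`, `0 ≤ i ≤ k`, of the fence poset of the straight segment `γ` from
`(0, 0)` to `(p, q)`, where `τ` is crossed by `γ`. -/
structure FencePoset (k : ℕ) (p q : ℤ) where
  /-- the crossing with `τ` -/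
  crossing : Crossing p q
  /-- the index in the chain of `τ` -/
  idx : Fin (k + 1)

/-- The relations `x ≺ y` that generate the order of the fence poset. -/
inductive FencePoset.Step {k : ℕ} {p q : ℤ} : FencePoset k p q → FencePoset k p q → Prop
  /-- `(τ, i) ≻ (τ, i + 1)` if the crossing is strictly closer to the right endpoint -/
  | chainDown (c : Crossing p q) (hc : c.CloserToRight) (i : Fin k) :
      Step ⟨c, i.succ⟩ ⟨c, i.castSucc⟩
  /-- `(τ, i) ≺ (τ, i + 1)` otherwise -/
  | chainUp (c : Crossing p q) (hc : ¬ c.CloserToRight) (i : Fin k) :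
      Step ⟨c, i.castSucc⟩ ⟨c, i.succ⟩
  /-- `(τ, k) ≻ (τ', 0)` if the common endpoint of `τ`, `τ'` lies to the right of `γ` -/
  | linkDown (c c' : Crossing p q) (h : c.Consecutive c') (P : ℤ × ℤ)
      (hP : c.seg.IsEndpoint P) (hP' : c'.seg.IsEndpoint P) (hr : RightOf p q P) :
      Step ⟨c', 0⟩ ⟨c, Fin.last k⟩
  /-- `(τ, k) ≺ (τ', 0)` if the common endpoint of `τ`, `τ'` lies to the left of `γ` -/
  | linkUp (c c' : Crossing p q) (h : c.Consecutive c') (P : ℤ × ℤ)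
      (hP : c.seg.IsEndpoint P) (hP' : c'.seg.IsEndpoint P) (hl : LeftOf p q P) :
      Step ⟨c, Fin.last k⟩ ⟨c', 0⟩

/-- The order of the fence poset: the reflexive transitive closure of the generating relations.
(Only the laws of a preorder are recorded; counting order ideals needs no more.) -/
instance (k : ℕ) (p q : ℤ) : Preorder (FencePoset k p q) where
  le := Relation.ReflTransGen FencePoset.Step
  le_refl _ := Relation.ReflTransGen.refl
  le_trans _ _ _ h h' := h.trans h'

end KMarkov

/-- For coprime `p`, `q`, the number `m^{(k)}_{q/p} = m^{(k)}_{(p,q)}`: the number of order ideals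
(downward closed subsets, including the empty one) of the fence poset of the straight segment
from `(0, 0)` to `(p, q)`. -/
noncomputable def kMarkovNumber (k : ℕ) (p q : ℤ) : ℕ :=
  Nat.card (LowerSet (KMarkov.FencePoset k p q))

/-! The fence poset is a zigzag path, so its order ideals are counted by a transfer matrix. Record
the numbers of ideals of an initial piece that do and do not contain the last element; adding a
larger or smaller element acts by one of two unipotent matrices, which are transposes of each other
(`step`). A word of signs therefore gives a product of such matrices, and the count is the pairing
of the resulting vector with `(1, 1)`.

The rotation of the lattice about the midpoint of `γ` reverses the order of the crossings and
exchanges left and right. Hence the word is the negative of its own reversal, except for the block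
of the middle crossing: there neither endpoint is strictly closer, so the chain increases.
Transposing the second half of the product onto the first turns the count into `x ^ 2 + y ^ 2 + k *
x * y`, where `(x, y)` is the state at the middle (`pair_blockState_of_symm`).

For both families the middle state evolves periodically, under a fixed matrix `M` of determinant 1
and trace `2k + 3`, respectively `β`. The form `det (v, M v)` is invariant under `M`, and the defect
of the central form from the homogeneous recurrence with that trace is a multiple of it. Its
constant value yields the terms `-k` and `-k(k + 2)`. The closed forms and asymptotics are then
those of a second-order linear recurrence with a dominant root. -/

namespace KMarkov

/-! ### Order ideals of a fence by transfer matrices -/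

/-- One step of the transfer recursion for the numbers of order ideals of a fence that do,
respectively do not, contain the last element; the new element is larger than the last one if
`b` is `true`, and smaller otherwise. -/
def step : Bool → ℕ × ℕ → ℕ × ℕ
  | true, v => (v.1, v.1 + v.2)
  | false, v => (v.1 + v.2, v.2)

/-- The transfer recursion along the word `w`. -/
def state (w : ℕ → Bool) : ℕ → ℕ × ℕ
  | 0 => (1, 1)
  | m + 1 => step (w m) (state w m)

/-- The order ideals of the fence on `0, …, m` in which `i < i + 1` if `w i` is `true`, and
`i + 1 < i` otherwise. -/
def fenceIdeals (w : ℕ → Bool) (m : ℕ) : Set (Fin (m + 1) → Prop) :=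
  {f | ∀ i : Fin m, (w i = true → f i.succ → f i.castSucc) ∧
    (w i = false → f i.castSucc → f i.succ)}

lemma snoc_mem_fenceIdeals (w : ℕ → Bool) (m : ℕ) (f : Fin (m + 1) → Prop) (a : Prop) :
    (Fin.snoc f a : Fin (m + 2) → Prop) ∈ fenceIdeals w (m + 1) ↔
      f ∈ fenceIdeals w m ∧ (w m = true → a → f (Fin.last m)) ∧
        (w m = false → f (Fin.last m) → a) := by
  simp only [fenceIdeals, Set.mem_ofPred_eq]
  rw [Fin.forall_fin_succ']
  simp only [Fin.succ_castSucc, Fin.snoc_castSucc, Fin.succ_last, Fin.snoc_last, Fin.val_castSucc,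
    Fin.val_last]

lemma ncard_snoc (m : ℕ) (a : Prop) (s : Set (Fin (m + 1) → Prop)) :
    ((fun f => (Fin.snoc f a : Fin (m + 2) → Prop)) '' s).ncard = s.ncard := by
  apply Set.ncard_image_of_injective
  intro f g h
  have := congrArg (fun x : Fin (m + 2) → Prop => (Fin.init x : Fin (m + 1) → Prop)) h
  simpa using this

lemma mem_image_snoc (m : ℕ) (a : Prop) (s : Set (Fin (m + 1) → Prop)) (f : Fin (m + 2) → Prop) :
    f ∈ (fun f => (Fin.snoc f a : Fin (m + 2) → Prop)) '' s ↔
      (Fin.init f : Fin (m + 1) → Prop) ∈ s ∧ (f (Fin.last (m + 1)) ↔ a) := by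
  constructor
  · rintro ⟨g, hg, rfl⟩
    simpa using hg
  · rintro ⟨h1, h2⟩
    refine ⟨_, h1, ?_⟩
    have : f (Fin.last (m + 1)) = a := propext h2
    rw [← this]
    exact Fin.snoc_init_self f

lemma mem_fenceIdeals_succ (w : ℕ → Bool) (m : ℕ) (f : Fin (m + 2) → Prop) :
    f ∈ fenceIdeals w (m + 1) ↔
      (Fin.init f : Fin (m + 1) → Prop) ∈ fenceIdeals w m ∧
        (w m = true → f (Fin.last (m + 1)) → (Fin.init f : Fin (m + 1) → Prop) (Fin.last m)) ∧
        (w m = false → (Fin.init f : Fin (m + 1) → Prop) (Fin.last m) →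
          f (Fin.last (m + 1))) := by
  conv_lhs => rw [← Fin.snoc_init_self f]
  exact snoc_mem_fenceIdeals w m _ _

lemma ncard_eq_add (m : ℕ) (s : Set (Fin (m + 1) → Prop)) :
    s.ncard = {f | f ∈ s ∧ f (Fin.last m)}.ncard + {f | f ∈ s ∧ ¬ f (Fin.last m)}.ncard := by
  rw [← Set.ncard_union_eq]
  · congr 1
    ext f
    simp only [Set.mem_union, Set.mem_ofPred_eq]
    tauto
  · rw [Set.disjoint_left]
    rintro f ⟨_, h⟩ ⟨_, h'⟩
    exact h' h

/-- Only the last element constrains the new one. If the new element is larger, an ideal containing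
it must contain the last one, while an ideal avoiding it is unconstrained; for a smaller element the
roles are exchanged. -/
lemma ncard_fenceIdeals_last (w : ℕ → Bool) (m : ℕ) :
    {f | f ∈ fenceIdeals w m ∧ f (Fin.last m)}.ncard = (state w m).1 ∧
    {f | f ∈ fenceIdeals w m ∧ ¬ f (Fin.last m)}.ncard = (state w m).2 := by
  induction m with
  | zero =>
    constructor
    · refine Set.ncard_eq_one.2 ⟨fun _ => True, ?_⟩
      ext f
      simp only [fenceIdeals, Set.mem_ofPred_eq, Set.mem_singleton_iff, IsEmpty.forall_iff,
        true_and]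
      refine ⟨fun h => ?_, fun h => by simp [h]⟩
      funext i
      rw [show i = Fin.last 0 from Fin.ext (by omega)]
      exact propext ⟨fun _ => trivial, fun _ => h⟩
    · refine Set.ncard_eq_one.2 ⟨fun _ => False, ?_⟩
      ext f
      simp only [fenceIdeals, Set.mem_ofPred_eq, Set.mem_singleton_iff, IsEmpty.forall_iff,
        true_and]
      refine ⟨fun h => ?_, fun h => by simp [h]⟩
      funext i
      rw [show i = Fin.last 0 from Fin.ext (by omega)]
      exact propext ⟨h, False.elim⟩
  | succ m ih =>
    obtain ⟨ih1, ih2⟩ := ih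
    have hall := ncard_eq_add m (fenceIdeals w m)
    rw [ih1, ih2] at hall
    cases hw : w m
    · constructor
      · rw [state, hw, step, ← hall, ← ncard_snoc m True]
        congr 1
        ext f
        rw [mem_image_snoc, Set.mem_ofPred_eq, mem_fenceIdeals_succ, hw]
        tauto
      · rw [state, hw, step, ← ih2, ← ncard_snoc m False]
        congr 1
        ext f
        rw [mem_image_snoc, Set.mem_ofPred_eq, mem_fenceIdeals_succ, hw, Set.mem_ofPred_eq]
        tauto
    · constructor
      · rw [state, hw, step, ← ih1, ← ncard_snoc m True]
        congr 1
        ext f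
        rw [mem_image_snoc, Set.mem_ofPred_eq, mem_fenceIdeals_succ, hw, Set.mem_ofPred_eq]
        tauto
      · rw [state, hw, step, ← hall, ← ncard_snoc m False]
        congr 1
        ext f
        rw [mem_image_snoc, Set.mem_ofPred_eq, mem_fenceIdeals_succ, hw]
        tauto

lemma ncard_fenceIdeals (w : ℕ → Bool) (m : ℕ) :
    (fenceIdeals w m).ncard = (state w m).1 + (state w m).2 := by
  rw [ncard_eq_add, (ncard_fenceIdeals_last w m).1, (ncard_fenceIdeals_last w m).2]

/-! ### Words made of blocks -/

/-- The transfer recursion along a word made of blocks: the `j`-th block consists of `k` copies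
of `chain j`, followed by `link j`. -/
def blockState (k : ℕ) (chain link : ℕ → Bool) : ℕ → ℕ × ℕ
  | 0 => (1, 1)
  | j + 1 => step (link j) ((step (chain j))^[k] (blockState k chain link j))

/-- The word made of the blocks described in `blockState`. -/
def blockWord (k : ℕ) (chain link : ℕ → Bool) (m : ℕ) : Bool :=
  if m % (k + 1) < k then chain (m / (k + 1)) else link (m / (k + 1))

lemma blockWord_chain (k : ℕ) (chain link : ℕ → Bool) (j : ℕ) {i : ℕ} (hi : i < k) :
    blockWord k chain link (j * (k + 1) + i) = chain j := by
  have h1 : (j * (k + 1) + i) % (k + 1) = i := by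
    rw [Nat.mul_add_mod_self_right, Nat.mod_eq_of_lt (by omega)]
  have h2 : (j * (k + 1) + i) / (k + 1) = j := by
    rw [mul_comm, Nat.mul_add_div (by omega), Nat.div_eq_of_lt (by omega), add_zero]
  rw [blockWord, h1, h2, if_pos hi]

lemma blockWord_link (k : ℕ) (chain link : ℕ → Bool) (j : ℕ) :
    blockWord k chain link (j * (k + 1) + k) = link j := by
  have h1 : (j * (k + 1) + k) % (k + 1) = k := by
    rw [Nat.mul_add_mod_self_right, Nat.mod_eq_of_lt (by omega)]
  have h2 : (j * (k + 1) + k) / (k + 1) = j := by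
    rw [mul_comm, Nat.mul_add_div (by omega), Nat.div_eq_of_lt (by omega), add_zero]
  rw [blockWord, h1, h2, if_neg (lt_irrefl k)]

lemma state_blockWord_chain (k : ℕ) (chain link : ℕ → Bool) (j : ℕ)
    (hj : state (blockWord k chain link) (j * (k + 1)) = blockState k chain link j) {i : ℕ}
    (hi : i ≤ k) :
    state (blockWord k chain link) (j * (k + 1) + i) =
      (step (chain j))^[i] (blockState k chain link j) := by
  induction i with
  | zero => simpa using hj
  | succ i ih =>
    rw [← add_assoc, state, ih (by omega), blockWord_chain k chain link j (by omega),
      Function.iterate_succ_apply']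

/-- A crossing contributes `k + 1` elements, so the index `j * (k + 1)` is the first element of
block `j`: `blockState` stops before the chain of that block. -/
lemma state_blockWord (k : ℕ) (chain link : ℕ → Bool) (j : ℕ) :
    state (blockWord k chain link) (j * (k + 1)) = blockState k chain link j := by
  induction j with
  | zero => simp [state, blockState]
  | succ j ih =>
    rw [show (j + 1) * (k + 1) = j * (k + 1) + k + 1 by ring, state,
      state_blockWord_chain k chain link j ih le_rfl, blockWord_link, blockState]

/-! ### Transposition and the central symmetry -/

/-- The standard pairing. -/
def pair (u v : ℕ × ℕ) : ℕ := u.1 * v.1 + u.2 * v.2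

/-- The matrices of `step true` and `step false` are transposes of each other. -/
lemma pair_step (b : Bool) (u v : ℕ × ℕ) : pair u (step b v) = pair (step (!b) u) v := by
  cases b <;> simp [pair, step] <;> ring

lemma pair_step_iterate (b : Bool) (k : ℕ) (u v : ℕ × ℕ) :
    pair u ((step b)^[k] v) = pair ((step (!b))^[k] u) v := by
  induction k generalizing v with
  | zero => rfl
  | succ k ih => rw [Function.iterate_succ_apply, ih, pair_step, Function.iterate_succ_apply']

lemma step_true_iterate (k : ℕ) (v : ℕ × ℕ) : (step true)^[k] v = (v.1, k * v.1 + v.2) := by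
  induction k with
  | zero => simp
  | succ k ih =>
    rw [Function.iterate_succ_apply', ih, step]
    ext <;> simp
    ring

lemma step_false_iterate (k : ℕ) (v : ℕ × ℕ) : (step false)^[k] v = (v.1 + k * v.2, v.2) := by
  induction k with
  | zero => simp
  | succ k ih =>
    rw [Function.iterate_succ_apply', ih, step]
    ext <;> simp
    ring

/-- The number of order ideals of a fence whose word is reversed up to sign by the central
symmetry, except for the central block, which is increasing. -/
lemma pair_blockState_of_symm (k c : ℕ) (chain link : ℕ → Bool)
    (hchain : ∀ r < c, chain (2 * c - r) = !chain r)
    (hlink : ∀ r < c, link (2 * c - 1 - r) = !link r) (hc : chain c = true) :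
    pair (1, 1) ((step (chain (2 * c)))^[k] (blockState k chain link (2 * c))) =
      (blockState k chain link c).1 ^ 2 + (blockState k chain link c).2 ^ 2 +
        k * ((blockState k chain link c).1 * (blockState k chain link c).2) := by
  -- Invariant: the outermost `r` blocks on the right have been moved to the left argument by
  -- transposition. By the symmetry they rebuild there exactly the first `r` blocks; at `r = c` only
  -- the middle chain remains.
  have key : ∀ r ≤ c, pair (1, 1) ((step (chain (2 * c)))^[k] (blockState k chain link (2 * c))) =
      pair (blockState k chain link r)
        ((step (chain (2 * c - r)))^[k] (blockState k chain link (2 * c - r))) := by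
    intro r
    induction r with
    | zero => intro _; rfl
    | succ r ih =>
      intro hr
      rw [ih (by omega), show blockState k chain link (2 * c - r) =
        blockState k chain link (2 * c - 1 - r + 1) by congr 1; omega, blockState,
        pair_step_iterate, pair_step, hchain r (by omega), hlink r (by omega), Bool.not_not,
        Bool.not_not, blockState, show 2 * c - (r + 1) = 2 * c - 1 - r by omega]
  rw [key c le_rfl, show 2 * c - c = c by omega, hc, step_true_iterate, pair]
  ring

/-! ### The fence poset as the fence of a block word -/

lemma mem_fenceIdeals_iff (w : ℕ → Bool) (m : ℕ) (f : Fin (m + 1) → Prop) :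
    f ∈ fenceIdeals w m ↔ ∀ (i : ℕ) (h : i < m),
      (w i = true → f ⟨i + 1, by omega⟩ → f ⟨i, by omega⟩) ∧
        (w i = false → f ⟨i, by omega⟩ → f ⟨i + 1, by omega⟩) :=
  ⟨fun hf i h => hf ⟨i, h⟩, fun hf i => hf i i.2⟩

lemma consecutive_iff {p q : ℤ} {n : ℕ} (e : Fin (n + 1) ≃ Crossing p q)
    (he : StrictMono fun j => (e j).t) (i j : Fin (n + 1)) :
    (e i).Consecutive (e j) ↔ (i : ℕ) + 1 = j := by
  have hlt : ∀ a b, (e a).t < (e b).t ↔ a < b := fun a b => he.lt_iff_lt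
  constructor
  · rintro ⟨h1, h2⟩
    rw [hlt] at h1
    by_contra hne
    have hlt' : (i : ℕ) + 1 < j := by
      have : (i : ℕ) < j := h1
      omega
    refine h2 (e ⟨i + 1, by omega⟩) ⟨(hlt _ _).2 ?_, (hlt _ _).2 ?_⟩
    · exact Fin.lt_def.2 (Nat.lt_succ_self _)
    · exact Fin.lt_def.2 hlt'
  · intro h
    refine ⟨(hlt _ _).2 (Fin.lt_def.2 (by omega)), fun d hd => ?_⟩
    obtain ⟨a, rfl⟩ := e.surjective d
    rw [hlt, hlt, Fin.lt_def, Fin.lt_def] at hd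
    omega

/-- The elements of the fence poset, listed along `γ`. -/
def FencePoset.enum {p q : ℤ} {n : ℕ} (k : ℕ) (e : Fin (n + 1) ≃ Crossing p q) :
    Fin (n * (k + 1) + k + 1) ≃ FencePoset k p q where
  toFun m := ⟨e ⟨m / (k + 1), by
      rw [Nat.div_lt_iff_lt_mul (by omega)]
      have := m.2
      linarith⟩, ⟨m % (k + 1), Nat.mod_lt _ (by omega)⟩⟩
  invFun y := ⟨(e.symm y.crossing : ℕ) * (k + 1) + y.idx, by
      have h1 : (e.symm y.crossing : ℕ) ≤ n := by omega
      have h2 := y.idx.2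
      have h3 := Nat.mul_le_mul_right (k + 1) h1
      omega⟩
  left_inv m := by
    apply Fin.ext
    simp only [Equiv.symm_apply_apply]
    exact Nat.div_add_mod' _ _
  right_inv y := by
    obtain ⟨d, i⟩ := y
    have h1 : ((e.symm d : ℕ) * (k + 1) + i) % (k + 1) = i := by
      rw [Nat.mul_add_mod_self_right, Nat.mod_eq_of_lt i.2]
    have h2 : ((e.symm d : ℕ) * (k + 1) + i) / (k + 1) = (e.symm d : ℕ) := by
      rw [mul_comm, Nat.mul_add_div (by omega), Nat.div_eq_of_lt i.2, add_zero]
    simp only [h1, h2, Fin.eta, Equiv.apply_symm_apply]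

lemma FencePoset.val_enum_symm {p q : ℤ} {n : ℕ} (k : ℕ) (e : Fin (n + 1) ≃ Crossing p q)
    (j : Fin (n + 1)) (i : Fin (k + 1)) :
    ((enum k e).symm ⟨e j, i⟩ : ℕ) = j * (k + 1) + i := by
  simp [enum]

lemma FencePoset.enum_mk {p q : ℤ} {n : ℕ} (k : ℕ) (e : Fin (n + 1) ≃ Crossing p q)
    (j : Fin (n + 1)) (i : Fin (k + 1)) (m : Fin (n * (k + 1) + k + 1))
    (hm : (m : ℕ) = j * (k + 1) + i) : enum k e m = ⟨e j, i⟩ := by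
  rw [← Equiv.eq_symm_apply]
  exact Fin.ext (by rw [hm, val_enum_symm])

section Count

variable {p q : ℤ} {n k : ℕ} (e : Fin (n + 1) ≃ Crossing p q) {chain link : ℕ → Bool}

/-- Each letter of the word must come from a generating relation, so one common endpoint on the
right side is enough for every link. -/
lemma mem_fenceIdeals_of_lowerSet (he : StrictMono fun j => (e j).t)
    (hchain : ∀ j, (e j).CloserToRight ↔ chain j = false)
    (hlink : ∀ j (h : j < n), ∃ P, (e ⟨j, by omega⟩).seg.IsEndpoint P ∧
      (e ⟨j + 1, by omega⟩).seg.IsEndpoint P ∧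
        (link j = true → LeftOf p q P) ∧ (link j = false → RightOf p q P))
    (S : LowerSet (FencePoset k p q)) :
    (fun m => FencePoset.enum k e m ∈ S) ∈
      fenceIdeals (blockWord k chain link) (n * (k + 1) + k) := by
  have hS : ∀ x y, FencePoset.Step x y → y ∈ S → x ∈ S := fun x y h hy =>
    S.lower (Relation.ReflTransGen.single h : x ≤ y) hy
  rw [mem_fenceIdeals_iff]
  intro m hm
  obtain ⟨j, i, hi, rfl⟩ : ∃ j i, i ≤ k ∧ m = j * (k + 1) + i :=
    ⟨m / (k + 1), m % (k + 1), Nat.le_of_lt_succ (Nat.mod_lt _ (by omega)),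
      (Nat.div_add_mod' _ _).symm⟩
  have hj : j < n + 1 := by
    by_contra! h
    have := Nat.mul_le_mul_right (k + 1) h
    linarith
  rcases hi.lt_or_eq with hi | rfl
  · rw [blockWord_chain k chain link j hi]
    have h0 := FencePoset.enum_mk k e ⟨j, hj⟩ (Fin.castSucc ⟨i, hi⟩)
      ⟨j * (k + 1) + i, by omega⟩ rfl
    have h1 := FencePoset.enum_mk k e ⟨j, hj⟩ (Fin.succ ⟨i, hi⟩)
      ⟨j * (k + 1) + i + 1, by omega⟩ rfl
    simp only [h0, h1]
    constructor
    · intro hw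
      refine hS _ _ (FencePoset.Step.chainUp _ ?_ _)
      rw [hchain]
      simp [hw]
    · intro hw
      exact hS _ _ (FencePoset.Step.chainDown _ ((hchain _).2 hw) _)
  · rw [blockWord_link]
    -- The last block has no link after it, since `m < n * (k + 1) + k`. Here `i = k` has eliminated
    -- `k`.
    have hj' : j < n := by
      by_contra! h
      have := Nat.mul_le_mul_right (i + 1) h
      omega
    have h0 := FencePoset.enum_mk i e ⟨j, hj⟩ (Fin.last i)
      ⟨j * (i + 1) + i, by omega⟩ rfl
    have h1 := FencePoset.enum_mk i e ⟨j + 1, by omega⟩ 0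
      ⟨j * (i + 1) + i + 1, by omega⟩ (by simp; ring)
    simp only [h0, h1]
    obtain ⟨P, hP, hP', hl, hr⟩ := hlink j hj'
    have hcons := (consecutive_iff e he ⟨j, by omega⟩ ⟨j + 1, by omega⟩).2 rfl
    exact ⟨fun hw => hS _ _ (FencePoset.Step.linkUp _ _ hcons P hP hP' (hl hw)),
      fun hw => hS _ _ (FencePoset.Step.linkDown _ _ hcons P hP hP' (hr hw))⟩

/-- Conversely every generating relation must agree with the word. A link relation may be produced
by any common endpoint, so `hlink` is required for all of them. The order being a reflexive
transitive closure, closure under single steps suffices. -/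
lemma isLowerSet_of_mem_fenceIdeals (he : StrictMono fun j => (e j).t)
    (hchain : ∀ j, (e j).CloserToRight ↔ chain j = false)
    (hlink : ∀ j (h : j < n), ∀ P, (e ⟨j, by omega⟩).seg.IsEndpoint P →
      (e ⟨j + 1, by omega⟩).seg.IsEndpoint P →
        (link j = true → LeftOf p q P) ∧ (link j = false → RightOf p q P))
    {f : Fin (n * (k + 1) + k + 1) → Prop}
    (hf : f ∈ fenceIdeals (blockWord k chain link) (n * (k + 1) + k)) :
    IsLowerSet {x | f ((FencePoset.enum k e).symm x)} := by
  have hstep : ∀ x y, FencePoset.Step x y → f ((FencePoset.enum k e).symm y) →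
      f ((FencePoset.enum k e).symm x) := by
    rw [mem_fenceIdeals_iff] at hf
    have hidx : ∀ (j : Fin (n + 1)) (i : Fin (k + 1)) (h : (j * (k + 1) + i : ℕ) < _),
        (FencePoset.enum k e).symm ⟨e j, i⟩ = ⟨j * (k + 1) + i, h⟩ := fun j i h =>
      Fin.ext (FencePoset.val_enum_symm k e j i)
    have hlt : ∀ (j : Fin (n + 1)) (i : Fin (k + 1)), (j * (k + 1) + i : ℕ) < n * (k + 1) + k + 1 :=
      fun j i => by rw [← FencePoset.val_enum_symm k e]; exact Fin.isLt _
    have hmul : ∀ j j' : Fin (n + 1), (j : ℕ) + 1 = j' →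
        (j' * (k + 1) : ℕ) = j * (k + 1) + k + 1 := fun j j' h => by rw [← h]; ring
    -- The first element of a block directly follows the last element of the previous one; this form
    -- of the index matches the letter at `j * (k + 1) + k`.
    have hL : ∀ (j j' : Fin (n + 1)) (h : (j : ℕ) + 1 = j'),
        (FencePoset.enum k e).symm ⟨e j', 0⟩ =
          ⟨j * (k + 1) + k + 1, (hmul j j' h) ▸ (hlt j' 0)⟩ := by
      intro j j' h
      apply Fin.ext
      rw [FencePoset.val_enum_symm]
      exact hmul j j' h
    have side : ∀ P : ℤ × ℤ, RightOf p q P → LeftOf p q P → False := fun P h h' =>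
      lt_asymm h h'
    intro x y h
    cases h with
    | chainDown c hc i =>
      obtain ⟨j, rfl⟩ := e.surjective c
      rw [hidx _ _ (hlt _ _), hidx _ _ (hlt _ _)]
      refine (hf (j * (k + 1) + i) ?_).2 ?_
      · have := hlt j i.succ
        simp only [Fin.val_succ] at this
        omega
      · rw [blockWord_chain _ _ _ _ i.2, ← hchain]
        exact hc
    | chainUp c hc i =>
      obtain ⟨j, rfl⟩ := e.surjective c
      rw [hidx _ _ (hlt _ _), hidx _ _ (hlt _ _)]
      refine (hf (j * (k + 1) + i) ?_).1 ?_
      · have := hlt j i.succ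
        simp only [Fin.val_succ] at this
        omega
      · rw [blockWord_chain _ _ _ _ i.2]
        rw [hchain] at hc
        simpa using hc
    | linkDown c c' h P hP hP' hr =>
      obtain ⟨j, rfl⟩ := e.surjective c
      obtain ⟨j', rfl⟩ := e.surjective c'
      have hjj := (consecutive_iff e he j j').1 h
      rw [hidx j _ (hlt _ _), hL j j' hjj]
      have hj : (j : ℕ) < n := by omega
      refine (hf (j * (k + 1) + k) ?_).2 ?_
      · have := Nat.mul_le_mul_right (k + 1) (Nat.succ_le_of_lt hj)
        rw [Nat.succ_mul] at this
        omega
      · rw [blockWord_link]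
        have hP2 := hlink j hj P hP (by
          rwa [show (⟨j + 1, by omega⟩ : Fin (n + 1)) = j' from Fin.ext hjj])
        by_contra hne
        exact side P hr (hP2.1 (by simpa using hne))
    | linkUp c c' h P hP hP' hl =>
      obtain ⟨j, rfl⟩ := e.surjective c
      obtain ⟨j', rfl⟩ := e.surjective c'
      have hjj := (consecutive_iff e he j j').1 h
      rw [hidx j _ (hlt _ _), hL j j' hjj]
      have hj : (j : ℕ) < n := by omega
      refine (hf (j * (k + 1) + k) ?_).1 ?_
      · have := Nat.mul_le_mul_right (k + 1) (Nat.succ_le_of_lt hj)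
        rw [Nat.succ_mul] at this
        omega
      · rw [blockWord_link]
        have hP2 := hlink j hj P hP (by
          rwa [show (⟨j + 1, by omega⟩ : Fin (n + 1)) = j' from Fin.ext hjj])
        by_contra hne
        exact side P (hP2.2 (by simpa using hne)) hl
  intro a b hba ha
  change Relation.ReflTransGen FencePoset.Step b a at hba
  induction hba using Relation.ReflTransGen.head_induction_on with
  | refl => exact ha
  | head h _ ih => exact hstep _ _ h ih

/-- The order ideals of the fence poset are those of the fence of its block word. -/
theorem card_lowerSet_fencePoset (he : StrictMono fun j => (e j).t)
    (hchain : ∀ j, (e j).CloserToRight ↔ chain j = false)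
    (hex : ∀ j (h : j < n), ∃ P, (e ⟨j, by omega⟩).seg.IsEndpoint P ∧
      (e ⟨j + 1, by omega⟩).seg.IsEndpoint P)
    (hlink : ∀ j (h : j < n), ∀ P, (e ⟨j, by omega⟩).seg.IsEndpoint P →
      (e ⟨j + 1, by omega⟩).seg.IsEndpoint P →
        (link j = true → LeftOf p q P) ∧ (link j = false → RightOf p q P)) :
    Nat.card (LowerSet (FencePoset k p q)) =
      pair (1, 1) ((step (chain n))^[k] (blockState k chain link n)) := by
  have h1 : Nat.card (LowerSet (FencePoset k p q)) =
      (fenceIdeals (blockWord k chain link) (n * (k + 1) + k)).ncard := by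
    rw [← Nat.card_coe_set_eq]
    refine Nat.card_congr
      { toFun := fun S => ⟨fun m => FencePoset.enum k e m ∈ S,
          mem_fenceIdeals_of_lowerSet e he hchain (fun j h => ?_) S⟩
        invFun := fun f => ⟨_, isLowerSet_of_mem_fenceIdeals e he hchain hlink f.2⟩
        left_inv := fun S => ?_
        right_inv := fun f => ?_ }
    · obtain ⟨P, hP, hP'⟩ := hex j h
      exact ⟨P, hP, hP', hlink j h P hP hP'⟩
    · ext x
      change FencePoset.enum k e ((FencePoset.enum k e).symm x) ∈ S ↔ _
      rw [Equiv.apply_symm_apply]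
      rfl
    · apply Subtype.ext
      funext m
      change f.1 ((FencePoset.enum k e).symm (FencePoset.enum k e m)) = _
      rw [Equiv.symm_apply_apply]
  rw [h1, ncard_fenceIdeals, state_blockWord_chain k chain link n
    (state_blockWord k chain link n) le_rfl, pair, one_mul, one_mul]

end Count

/-! ### Crossings: Cramer's rule and integer coordinates -/

lemma Crossing.t_mul_det {p q : ℤ} (c : Crossing p q) :
    c.t * (det (p, q) c.seg.dir.vec : ℝ) = (det c.seg.src c.seg.dir.vec : ℝ) := by
  have h1 := c.eq_fst
  have h2 := c.eq_snd
  simp only [det]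
  push_cast
  linear_combination (c.seg.dir.vec.2 : ℝ) * h1 - (c.seg.dir.vec.1 : ℝ) * h2

lemma Crossing.s_mul_det {p q : ℤ} (c : Crossing p q) :
    c.s * (det (p, q) c.seg.dir.vec : ℝ) = -(det (p, q) c.seg.src : ℝ) := by
  have h1 := c.eq_fst
  have h2 := c.eq_snd
  simp only [det]
  push_cast
  linear_combination (q : ℝ) * h1 - (p : ℝ) * h2

/-- By transversality Cramer's rule determines `t` and `s` from the segment, so a list of crossings
is complete as soon as it contains every crossed segment. -/
lemma Crossing.eq_of_seg_eq {p q : ℤ} {c c' : Crossing p q} (h : c.seg = c'.seg) : c = c' := by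
  have h0 : (det (p, q) c.seg.dir.vec : ℝ) ≠ 0 := Int.cast_ne_zero.2 c.transversal
  have ht : c.t = c'.t := by
    apply mul_right_cancel₀ h0
    rw [c.t_mul_det, h, c'.t_mul_det]
  have hs : c.s = c'.s := by
    apply mul_right_cancel₀ h0
    rw [c.s_mul_det, h, c'.s_mul_det]
  cases c
  cases c'
  simp only at h ht hs
  subst h ht hs
  rfl

/-- A segment of `𝓛` together with a candidate for a crossing with it, at the position `A / D`
along `γ` and `B / D` along the segment. -/
structure CrossingData where
  /-- the segment -/
  seg : LatticeSegment
  /-- the numerator of the position along `γ` -/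
  A : ℤ
  /-- the numerator of the position along the segment -/
  B : ℤ
  /-- the common denominator -/
  D : ℤ

/-- The data describe a crossing. -/
structure CrossingData.Valid (p q : ℤ) (x : CrossingData) : Prop where
  A_pos : 0 < x.A
  A_lt : x.A < x.D
  B_pos : 0 < x.B
  B_lt : x.B < x.D
  transversal : det (p, q) x.seg.dir.vec ≠ 0
  eq_fst : x.A * p = x.D * x.seg.src.1 + x.B * x.seg.dir.vec.1
  eq_snd : x.A * q = x.D * x.seg.src.2 + x.B * x.seg.dir.vec.2

/-- The crossing described by the data. -/
noncomputable def CrossingData.Valid.crossing {p q : ℤ} {x : CrossingData} (h : x.Valid p q) :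
    Crossing p q where
  seg := x.seg
  t := x.A / x.D
  s := x.B / x.D
  t_pos := div_pos (Int.cast_pos.2 h.A_pos) (Int.cast_pos.2 (h.A_pos.trans h.A_lt))
  t_lt_one := (div_lt_one (Int.cast_pos.2 (h.A_pos.trans h.A_lt))).2 (Int.cast_lt.2 h.A_lt)
  s_pos := div_pos (Int.cast_pos.2 h.B_pos) (Int.cast_pos.2 (h.A_pos.trans h.A_lt))
  s_lt_one := (div_lt_one (Int.cast_pos.2 (h.A_pos.trans h.A_lt))).2 (Int.cast_lt.2 h.B_lt)
  transversal := h.transversal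
  eq_fst := by
    have hD : (x.D : ℝ) ≠ 0 := (Int.cast_pos.2 (h.A_pos.trans h.A_lt)).ne'
    have := congrArg (Int.cast : ℤ → ℝ) h.eq_fst
    push_cast at this
    field_simp
    linarith
  eq_snd := by
    have hD : (x.D : ℝ) ≠ 0 := (Int.cast_pos.2 (h.A_pos.trans h.A_lt)).ne'
    have := congrArg (Int.cast : ℤ → ℝ) h.eq_snd
    push_cast at this
    field_simp
    linarith

/-- The crossing described by the data is strictly closer to the right endpoint. -/
def CrossingData.CloserToRight (p q : ℤ) (x : CrossingData) : Prop :=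
  (RightOf p q x.seg.src ∧ 2 * x.B < x.D) ∨ (RightOf p q x.seg.tgt ∧ x.D < 2 * x.B)

lemma CrossingData.Valid.closerToRight_crossing {p q : ℤ} {x : CrossingData} (h : x.Valid p q) :
    h.crossing.CloserToRight ↔ x.CloserToRight p q := by
  have hD : (0 : ℝ) < x.D := Int.cast_pos.2 (h.A_pos.trans h.A_lt)
  have h1 : (x.B / x.D : ℝ) < 1 - x.B / x.D ↔ 2 * x.B < x.D := by
    rw [← @Int.cast_lt ℝ, lt_sub_iff_add_lt, ← add_div, div_lt_one hD]
    push_cast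
    rw [two_mul]
  have h2 : (1 : ℝ) - x.B / x.D < x.B / x.D ↔ x.D < 2 * x.B := by
    rw [← @Int.cast_lt ℝ, sub_lt_iff_lt_add, ← add_div, one_lt_div hD]
    push_cast
    rw [two_mul]
  simp only [Crossing.CloserToRight, CrossingData.CloserToRight, CrossingData.Valid.crossing, h1,
    h2]

/-- The number of order ideals of the fence poset, from a complete list of the crossings. -/
theorem kMarkovNumber_eq_pair {p q : ℤ} (k n : ℕ) (x : ℕ → CrossingData) (chain link : ℕ → Bool)
    (hx : ∀ j ≤ n, (x j).Valid p q)
    (hmono : ∀ j < n, (x j).A * (x (j + 1)).D < (x (j + 1)).A * (x j).D)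
    (hsurj : ∀ d : Crossing p q, ∃ j ≤ n, d.seg = (x j).seg)
    (hchain : ∀ j ≤ n, (x j).CloserToRight p q ↔ chain j = false)
    (hex : ∀ j < n, ∃ P, (x j).seg.IsEndpoint P ∧ (x (j + 1)).seg.IsEndpoint P)
    (hlink : ∀ j < n, ∀ P, (x j).seg.IsEndpoint P → (x (j + 1)).seg.IsEndpoint P →
      (link j = true → LeftOf p q P) ∧ (link j = false → RightOf p q P)) :
    kMarkovNumber k p q =
      pair (1, 1) ((step (chain n))^[k] (blockState k chain link n)) := by
  let e₀ : Fin (n + 1) → Crossing p q := fun j => (hx j (by omega)).crossing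
  have hmono' : StrictMono fun j => (e₀ j).t := by
    rw [Fin.strictMono_iff_lt_succ]
    intro i
    have h0 := hx i (by omega)
    have h1 := hx (i + 1) (by omega)
    change ((x i).A / (x i).D : ℝ) < (x (i + 1)).A / (x (i + 1)).D
    rw [div_lt_div_iff₀ (Int.cast_pos.2 (h0.A_pos.trans h0.A_lt))
      (Int.cast_pos.2 (h1.A_pos.trans h1.A_lt))]
    exact_mod_cast hmono i i.2
  have hbij : Function.Bijective e₀ := by
    refine ⟨fun a b hab => hmono'.injective (congrArg Crossing.t hab), fun d => ?_⟩
    obtain ⟨j, hj, hd⟩ := hsurj d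
    exact ⟨⟨j, by omega⟩, (Crossing.eq_of_seg_eq hd).symm⟩
  refine card_lowerSet_fencePoset (Equiv.ofBijective e₀ hbij) hmono' (fun j => ?_) hex hlink
  rw [← hchain j (by omega)]
  exact (hx j (by omega)).closerToRight_crossing

/-- If `γ` has no crossings, the fence poset is empty and has one order ideal. -/
theorem kMarkovNumber_eq_one {p q : ℤ} (k : ℕ) (h : IsEmpty (Crossing p q)) :
    kMarkovNumber k p q = 1 := by
  have : IsEmpty (FencePoset k p q) := ⟨fun x => h.false x.crossing⟩
  rw [kMarkovNumber, Nat.card_eq_one_iff_unique]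
  exact ⟨⟨fun a b => by ext x; exact this.elim x⟩, ⟨⊥⟩⟩

lemma isEmpty_crossing_zero_one : IsEmpty (Crossing 0 1) := by
  refine ⟨fun d => ?_⟩
  obtain ⟨⟨⟨X, Y⟩, dir⟩, t, s, ht0, ht1, hs0, hs1, htr, h1, h2⟩ := d
  cases dir <;> simp [det, Dir.vec] at htr h1 h2
  · have e1 : (-1 : ℝ) < X := by linarith
    have e2 : (X : ℝ) < 0 := by linarith
    norm_cast at e1 e2
    omega
  · have e1 : (-1 : ℝ) < X := by linarith
    have e2 : (X : ℝ) < 0 := by linarith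
    norm_cast at e1 e2
    omega

lemma isEmpty_crossing_one_zero : IsEmpty (Crossing 1 0) := by
  refine ⟨fun d => ?_⟩
  obtain ⟨⟨⟨X, Y⟩, dir⟩, t, s, ht0, ht1, hs0, hs1, htr, h1, h2⟩ := d
  cases dir <;> simp [det, Dir.vec] at htr h1 h2
  · have e1 : (0 : ℝ) < X := by linarith
    have e2 : (X : ℝ) < 1 := by linarith
    norm_cast at e1 e2
    omega
  · have e1 : (0 : ℝ) < Y := by linarith
    have e2 : (Y : ℝ) < 1 := by linarith
    norm_cast at e1 e2
    omega

/-! ### Crossings of the segment to `(c + 1, 1)`: antidiagonals and verticals alternate -/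

section Slope

/-- The crossings of the segment from `(0, 0)` to `(c + 1, 1)`. -/
def unitData (c : ℕ) (j : ℕ) : CrossingData :=
  if j % 2 = 0 then ⟨⟨((j / 2 : ℕ), 1), .antidiagonal⟩, (j / 2 : ℕ) + 1, c + 1 - (j / 2 : ℕ), c + 2⟩
  else ⟨⟨((j / 2 : ℕ) + 1, 0), .vertical⟩, (j / 2 : ℕ) + 1, (j / 2 : ℕ) + 1, c + 1⟩

lemma unitData_even (c a : ℕ) :
    unitData c (2 * a) = ⟨⟨(a, 1), .antidiagonal⟩, a + 1, c + 1 - a, c + 2⟩ := by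
  simp [unitData]

lemma unitData_odd (c a : ℕ) :
    unitData c (2 * a + 1) = ⟨⟨(a + 1, 0), .vertical⟩, a + 1, a + 1, c + 1⟩ := by
  have h : (2 * a + 1) / 2 = a := by omega
  simp [unitData, h, Nat.add_mod]

/-- The links of the fence of the segment from `(0, 0)` to `(n, 1)`. -/
def unitLink (j : ℕ) : Bool := decide (j % 2 = 1)

lemma unitData_valid (c j : ℕ) (hj : j ≤ 2 * c) :
    (unitData c j).Valid ((c + 1 : ℕ) : ℤ) 1 := by
  obtain ⟨a, rfl | rfl⟩ := Nat.even_or_odd' j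
  · rw [unitData_even]
    constructor <;> simp [det, Dir.vec] <;> first | omega | ring
  · rw [unitData_odd]
    constructor <;> simp [det, Dir.vec] <;> first | omega | ring

/-- The height of a point of `γ` is `t`, strictly between 0 and 1. This excludes horizontal segments
and fixes `Y` in the other two directions, leaving one segment for each admissible `X`. -/
lemma exists_unitData_seg_eq (c : ℕ) (d : Crossing ((c + 1 : ℕ) : ℤ) 1) :
    ∃ j ≤ 2 * c, d.seg = (unitData c j).seg := by
  obtain ⟨⟨⟨X, Y⟩, dir⟩, t, s, ht0, ht1, hs0, hs1, htr, h1, h2⟩ := d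
  have hc : (0 : ℝ) < c + 1 := by positivity
  have ht2 : 0 < t * (c + 1) := by positivity
  have ht3 : t * (c + 1) < c + 1 := by nlinarith
  cases dir <;> simp [Dir.vec] at h1 h2
  · have e1 : (0 : ℝ) < Y := by linarith
    have e2 : (Y : ℝ) < 1 := by linarith
    norm_cast at e1 e2
    omega
  · have e1 : (-1 : ℝ) < Y := by linarith
    have e2 : (Y : ℝ) < 1 := by linarith
    have e3 : (0 : ℝ) < X := by linarith
    have e4 : (X : ℝ) < c + 1 := by linarith
    norm_cast at e1 e2 e3 e4
    obtain ⟨a, ha⟩ := Int.eq_ofNat_of_zero_le (show 0 ≤ X - 1 by omega)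
    refine ⟨2 * a + 1, by omega, ?_⟩
    rw [unitData_odd]
    simp
    omega
  · have e1 : (0 : ℝ) < Y := by linarith
    have e2 : (Y : ℝ) < 2 := by linarith
    norm_cast at e1 e2
    obtain rfl : Y = 1 := by omega
    norm_num at h2
    have e3 : (-1 : ℝ) < X := by linarith
    have e4 : (X : ℝ) < c + 1 := by linarith
    norm_cast at e3 e4
    obtain ⟨a, ha⟩ := Int.eq_ofNat_of_zero_le (show 0 ≤ X by omega)
    refine ⟨2 * a, by omega, ?_⟩
    rw [unitData_even]
    simp
    omega

lemma unitData_lt (c j : ℕ) (hj : j < 2 * c) :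
    (unitData c j).A * (unitData c (j + 1)).D < (unitData c (j + 1)).A * (unitData c j).D := by
  obtain ⟨a, rfl | rfl⟩ := Nat.even_or_odd' j
  · rw [unitData_even, unitData_odd]
    nlinarith
  · rw [show 2 * a + 1 + 1 = 2 * (a + 1) by ring, unitData_even, unitData_odd]
    push_cast
    nlinarith

lemma unitData_closerToRight (c j : ℕ) (hj : j ≤ 2 * c) :
    (unitData c j).CloserToRight ((c + 1 : ℕ) : ℤ) 1 ↔ decide (c ≤ j) = false := by
  obtain ⟨a, rfl | rfl⟩ := Nat.even_or_odd' j
  · rw [unitData_even]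
    simp [CrossingData.CloserToRight, RightOf, det, LatticeSegment.tgt, Dir.vec]
    omega
  · rw [unitData_odd]
    simp [CrossingData.CloserToRight, RightOf, det, LatticeSegment.tgt, Dir.vec]
    omega

lemma exists_unitData_isEndpoint (c j : ℕ) :
    ∃ P, (unitData c j).seg.IsEndpoint P ∧ (unitData c (j + 1)).seg.IsEndpoint P := by
  obtain ⟨a, rfl | rfl⟩ := Nat.even_or_odd' j
  · rw [unitData_even, unitData_odd]
    exact ⟨(a + 1, 0), by simp [LatticeSegment.IsEndpoint, LatticeSegment.tgt, Dir.vec]⟩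
  · rw [show 2 * a + 1 + 1 = 2 * (a + 1) by ring, unitData_even, unitData_odd]
    exact ⟨(a + 1, 1), by simp [LatticeSegment.IsEndpoint, LatticeSegment.tgt, Dir.vec]⟩

lemma unitData_link (c j : ℕ) (hj : j < 2 * c) (P : ℤ × ℤ)
    (hP : (unitData c j).seg.IsEndpoint P) (hP' : (unitData c (j + 1)).seg.IsEndpoint P) :
    (unitLink j = true → LeftOf ((c + 1 : ℕ) : ℤ) 1 P) ∧
      (unitLink j = false → RightOf ((c + 1 : ℕ) : ℤ) 1 P) := by
  obtain ⟨x, y⟩ := P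
  obtain ⟨a, rfl | rfl⟩ := Nat.even_or_odd' j
  · rw [unitData_even] at hP
    rw [unitData_odd] at hP'
    simp [LatticeSegment.IsEndpoint, LatticeSegment.tgt, Dir.vec] at hP hP'
    obtain ⟨rfl, rfl⟩ : x = a + 1 ∧ y = 0 := by omega
    simp [unitLink, RightOf, det]
    omega
  · rw [unitData_odd] at hP
    rw [show 2 * a + 1 + 1 = 2 * (a + 1) by ring, unitData_even] at hP'
    simp [LatticeSegment.IsEndpoint, LatticeSegment.tgt, Dir.vec] at hP hP'
    obtain ⟨rfl, rfl⟩ : x = a + 1 ∧ y = 1 := by omega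
    simp [unitLink, LeftOf, det, Nat.add_mod]
    omega

end Slope

/-! ### Crossings of the segment to `(m + 2, m + 1)`: a pattern of period four -/

section Diagonal

/-- The crossings of the segment from `(0, 0)` to `(m + 2, m + 1)`. -/
def diagData (m : ℕ) (j : ℕ) : CrossingData :=
  if j % 4 = 0 then
    ⟨⟨((j / 4 : ℕ), (j / 4 : ℕ) + 1), .antidiagonal⟩, 2 * (j / 4 : ℕ) + 1, m + (j / 4 : ℕ) + 2,
      2 * m + 3⟩
  else if j % 4 = 1 then
    ⟨⟨((j / 4 : ℕ) + 1, (j / 4 : ℕ)), .vertical⟩, (j / 4 : ℕ) + 1, m + 1 - (j / 4 : ℕ), m + 2⟩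
  else if j % 4 = 2 then
    ⟨⟨((j / 4 : ℕ) + 1, (j / 4 : ℕ) + 1), .antidiagonal⟩, 2 * (j / 4 : ℕ) + 2, (j / 4 : ℕ) + 1,
      2 * m + 3⟩
  else
    ⟨⟨((j / 4 : ℕ) + 1, (j / 4 : ℕ) + 1), .horizontal⟩, (j / 4 : ℕ) + 1, (j / 4 : ℕ) + 1, m + 1⟩

lemma diagData_zero (m a : ℕ) :
    diagData m (4 * a) =
      ⟨⟨(a, a + 1), .antidiagonal⟩, 2 * a + 1, m + a + 2, 2 * m + 3⟩ := by
  simp [diagData]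

lemma diagData_one (m a : ℕ) :
    diagData m (4 * a + 1) = ⟨⟨(a + 1, a), .vertical⟩, a + 1, m + 1 - a, m + 2⟩ := by
  have h : (4 * a + 1) / 4 = a := by omega
  simp [diagData, h, Nat.add_mod]

lemma diagData_two (m a : ℕ) :
    diagData m (4 * a + 2) =
      ⟨⟨(a + 1, a + 1), .antidiagonal⟩, 2 * a + 2, a + 1, 2 * m + 3⟩ := by
  have h : (4 * a + 2) / 4 = a := by omega
  simp [diagData, h, Nat.add_mod]

lemma diagData_three (m a : ℕ) :
    diagData m (4 * a + 3) = ⟨⟨(a + 1, a + 1), .horizontal⟩, a + 1, a + 1, m + 1⟩ := by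
  have h : (4 * a + 3) / 4 = a := by omega
  simp [diagData, h, Nat.add_mod]

lemma eq_four_mul_add (j : ℕ) :
    ∃ a, j = 4 * a ∨ j = 4 * a + 1 ∨ j = 4 * a + 2 ∨ j = 4 * a + 3 :=
  ⟨j / 4, by omega⟩

/-- The chains of the fence of the segment from `(0, 0)` to `(m + 2, m + 1)`. -/
def diagChain (m j : ℕ) : Bool :=
  decide (j % 4 = 2 ∨ j % 2 = 1 ∧ j < 2 * m + 2)

/-- The links of the fence of the segment from `(0, 0)` to `(n + 1, n)`. -/
def diagLink (j : ℕ) : Bool := decide (j % 4 = 1 ∨ j % 4 = 2)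

lemma diagData_valid (m j : ℕ) (hj : j ≤ 4 * m + 2) :
    (diagData m j).Valid (((m + 1 : ℕ) : ℤ) + 1) ((m + 1 : ℕ) : ℤ) := by
  obtain ⟨a, rfl | rfl | rfl | rfl⟩ := eq_four_mul_add j
  · rw [diagData_zero]
    constructor <;> simp [det, Dir.vec] <;> first | omega | ring
  · rw [diagData_one]
    constructor <;> simp [det, Dir.vec] <;> first | omega | ring
  · rw [diagData_two]
    constructor <;> simp [det, Dir.vec] <;> first | omega | ring
  · rw [diagData_three]
    constructor <;> simp [det, Dir.vec] <;> first | omega | ring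

/-- Since `p - q = 1`, the difference of the coordinates along `γ` is `t`, strictly between 0 and 1.
This confines segments to a narrow strip: `X = Y` for horizontals, `Y = X - 1` for verticals, and `Y
= X` or `Y = X + 1` for antidiagonals. -/
lemma exists_diagData_seg_eq (m : ℕ) (d : Crossing (((m + 1 : ℕ) : ℤ) + 1) ((m + 1 : ℕ) : ℤ)) :
    ∃ j ≤ 4 * m + 2, d.seg = (diagData m j).seg := by
  obtain ⟨⟨⟨X, Y⟩, dir⟩, t, s, ht0, ht1, hs0, hs1, htr, h1, h2⟩ := d
  have hc : (0 : ℝ) < m + 1 := by positivity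
  have ht2 : 0 < t * (m + 1) := by positivity
  have ht3 : t * (m + 1) < m + 1 := by nlinarith
  cases dir <;> simp [Dir.vec] at h1 h2
  · have e1 : (0 : ℝ) < Y := by linarith
    have e2 : (Y : ℝ) < m + 1 := by linarith
    have e3 : (X : ℝ) < Y + 1 := by linarith
    have e4 : (Y : ℝ) < X + 1 := by linarith
    norm_cast at e1 e2 e3 e4
    obtain ⟨a, ha⟩ := Int.eq_ofNat_of_zero_le (show 0 ≤ Y - 1 by omega)
    refine ⟨4 * a + 3, by omega, ?_⟩
    rw [diagData_three]
    simp
    omega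
  · have e1 : (0 : ℝ) < X := by linarith
    have e2 : (X : ℝ) < m + 1 + 1 := by linarith
    have e3 : (Y : ℝ) < X := by linarith
    have e4 : (X : ℝ) < Y + 2 := by linarith
    norm_cast at e1 e2 e3 e4
    obtain ⟨a, ha⟩ := Int.eq_ofNat_of_zero_le (show 0 ≤ X - 1 by omega)
    refine ⟨4 * a + 1, by omega, ?_⟩
    rw [diagData_one]
    simp
    omega
  · have e1 : (0 : ℝ) < X + Y := by linarith
    have e2 : (X : ℝ) + Y < 2 * m + 3 := by linarith
    have e3 : (X : ℝ) < Y + 1 := by linarith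
    have e4 : (Y : ℝ) < X + 2 := by linarith
    norm_cast at e1 e2 e3 e4
    rcases (show X = Y ∨ Y = X + 1 by omega) with h | h
    · obtain ⟨a, ha⟩ := Int.eq_ofNat_of_zero_le (show 0 ≤ X - 1 by omega)
      refine ⟨4 * a + 2, by omega, ?_⟩
      rw [diagData_two]
      simp
      omega
    · obtain ⟨a, ha⟩ := Int.eq_ofNat_of_zero_le (show 0 ≤ X by omega)
      refine ⟨4 * a, by omega, ?_⟩
      rw [diagData_zero]
      simp
      omega

lemma diagData_lt (m j : ℕ) (hj : j < 4 * m + 2) :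
    (diagData m j).A * (diagData m (j + 1)).D < (diagData m (j + 1)).A * (diagData m j).D := by
  obtain ⟨a, rfl | rfl | rfl | rfl⟩ := eq_four_mul_add j
  · rw [diagData_zero, diagData_one]
    nlinarith
  · rw [show 4 * a + 1 + 1 = 4 * a + 2 by ring, diagData_one, diagData_two]
    nlinarith
  · rw [show 4 * a + 2 + 1 = 4 * a + 3 by ring, diagData_two, diagData_three]
    nlinarith
  · rw [show 4 * a + 3 + 1 = 4 * (a + 1) by ring, diagData_zero, diagData_three]
    push_cast
    nlinarith

lemma diagData_closerToRight (m j : ℕ) (hj : j ≤ 4 * m + 2) :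
    (diagData m j).CloserToRight (((m + 1 : ℕ) : ℤ) + 1) ((m + 1 : ℕ) : ℤ) ↔
      diagChain m j = false := by
  obtain ⟨a, rfl | rfl | rfl | rfl⟩ := eq_four_mul_add j
  · have h1 : ((m : ℤ) + 1 + 1) * a - (m + 1) * (a + 1) < 0 := by linarith
    rw [diagData_zero]
    simp [CrossingData.CloserToRight, RightOf, det, LatticeSegment.tgt, Dir.vec, diagChain]
    refine ⟨fun _ => by omega, fun _ => Or.inr ⟨by linarith, by omega⟩⟩
  · rw [diagData_one]
    -- In each determinant the product of `m` and `a` cancels, so the side conditions become linear.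
    -- Disabling `sub_neg` keeps the differences in the shape that `h1` and `h2` rewrite.
    have h1 : ((m : ℤ) + 1 + 1) * a - (m + 1) * (a + 1) = a - m - 1 := by ring
    have h2 : ((m : ℤ) + 1 + 1) * (a + 1) - (m + 1) * (a + 1) = a + 1 := by ring
    simp [CrossingData.CloserToRight, RightOf, det, LatticeSegment.tgt, Dir.vec, diagChain,
      h1, h2, -sub_neg]
    omega
  · rw [diagData_two]
    have h1 : ((m : ℤ) + 1 + 1) * (a + 1) - (m + 1) * (a + 1) = a + 1 := by ring
    have h2 : ((m : ℤ) + 1 + 1) * a - (m + 1) * (a + 1 + 1) = a - 2 * m - 2 := by ring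
    simp [CrossingData.CloserToRight, RightOf, det, LatticeSegment.tgt, Dir.vec, diagChain,
      h1, h2, -sub_neg]
    omega
  · rw [diagData_three]
    have h1 : ((m : ℤ) + 1 + 1) * (a + 1) - (m + 1) * (a + 1) = a + 1 := by ring
    have h2 : ((m : ℤ) + 1 + 1) * (a + 1) - (m + 1) * (a + 1 + 1) = a - m := by ring
    simp [CrossingData.CloserToRight, RightOf, det, LatticeSegment.tgt, Dir.vec, diagChain,
      h1, h2, -sub_neg]
    omega

lemma exists_diagData_isEndpoint (m j : ℕ) :
    ∃ P, (diagData m j).seg.IsEndpoint P ∧ (diagData m (j + 1)).seg.IsEndpoint P := by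
  obtain ⟨a, rfl | rfl | rfl | rfl⟩ := eq_four_mul_add j
  · rw [diagData_zero, diagData_one]
    exact ⟨(a + 1, a), by simp [LatticeSegment.IsEndpoint, LatticeSegment.tgt, Dir.vec]⟩
  · rw [show 4 * a + 1 + 1 = 4 * a + 2 by ring, diagData_one, diagData_two]
    exact ⟨(a + 1, a + 1), by simp [LatticeSegment.IsEndpoint, LatticeSegment.tgt, Dir.vec]⟩
  · rw [show 4 * a + 2 + 1 = 4 * a + 3 by ring, diagData_two, diagData_three]
    exact ⟨(a + 1, a + 1), by simp [LatticeSegment.IsEndpoint, LatticeSegment.tgt, Dir.vec]⟩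
  · rw [show 4 * a + 3 + 1 = 4 * (a + 1) by ring, diagData_zero, diagData_three]
    exact ⟨(a + 2, a + 1), by
      simp [LatticeSegment.IsEndpoint, LatticeSegment.tgt, Dir.vec]; omega⟩

lemma diagData_link (m j : ℕ) (hj : j < 4 * m + 2) (P : ℤ × ℤ)
    (hP : (diagData m j).seg.IsEndpoint P) (hP' : (diagData m (j + 1)).seg.IsEndpoint P) :
    (diagLink j = true → LeftOf (((m + 1 : ℕ) : ℤ) + 1) ((m + 1 : ℕ) : ℤ) P) ∧
      (diagLink j = false → RightOf (((m + 1 : ℕ) : ℤ) + 1) ((m + 1 : ℕ) : ℤ) P) := by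
  obtain ⟨x, y⟩ := P
  obtain ⟨a, rfl | rfl | rfl | rfl⟩ := eq_four_mul_add j
  · rw [diagData_zero] at hP
    rw [diagData_one] at hP'
    simp [LatticeSegment.IsEndpoint, LatticeSegment.tgt, Dir.vec] at hP hP'
    obtain ⟨rfl, rfl⟩ : x = a + 1 ∧ y = a := by omega
    have h1 : ((m : ℤ) + 1 + 1) * a - (m + 1) * (a + 1) = a - m - 1 := by ring
    simp [diagLink, RightOf, det, h1, -sub_neg]
    omega
  · rw [diagData_one] at hP
    rw [show 4 * a + 1 + 1 = 4 * a + 2 by ring, diagData_two] at hP'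
    simp [LatticeSegment.IsEndpoint, LatticeSegment.tgt, Dir.vec] at hP hP'
    obtain ⟨rfl, rfl⟩ : x = a + 1 ∧ y = a + 1 := by omega
    have h1 : ((m : ℤ) + 1 + 1) * (a + 1) - (m + 1) * (a + 1) = a + 1 := by ring
    simp [diagLink, LeftOf, det, h1, Nat.add_mod, -sub_pos]
  · rw [diagData_two] at hP
    rw [show 4 * a + 2 + 1 = 4 * a + 3 by ring, diagData_three] at hP'
    simp [LatticeSegment.IsEndpoint, LatticeSegment.tgt, Dir.vec] at hP hP'
    obtain ⟨rfl, rfl⟩ : x = a + 1 ∧ y = a + 1 := by omega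
    have h1 : ((m : ℤ) + 1 + 1) * (a + 1) - (m + 1) * (a + 1) = a + 1 := by ring
    simp [diagLink, LeftOf, det, h1, Nat.add_mod, -sub_pos]
  · rw [diagData_three] at hP
    rw [show 4 * a + 3 + 1 = 4 * (a + 1) by ring, diagData_zero] at hP'
    simp [LatticeSegment.IsEndpoint, LatticeSegment.tgt, Dir.vec] at hP hP'
    obtain ⟨rfl, rfl⟩ : x = a + 2 ∧ y = a + 1 := by omega
    have h1 : ((m : ℤ) + 1 + 1) * (a + 1) - (m + 1) * (a + 2) = a - m := by ring
    simp [diagLink, RightOf, det, h1, Nat.add_mod, -sub_neg]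
    omega

end Diagonal

/-! ### The count as a quadratic form in the middle state -/

/-- The quadratic form that computes the number of order ideals from the state at the centre. -/
def centralForm (k : ℕ) (v : ℕ × ℕ) : ℕ := v.1 ^ 2 + v.2 ^ 2 + k * (v.1 * v.2)

lemma blockState_congr {k c : ℕ} {chain chain' link : ℕ → Bool}
    (h : ∀ j < c, chain j = chain' j) :
    blockState k chain link c = blockState k chain' link c := by
  induction c with
  | zero => rfl
  | succ c ih => rw [blockState, blockState, ih fun j hj => h j (by omega), h c (by omega)]

/-- Of the `2 * c + 1` crossings, number `c` is the midpoint of `γ` and of its segment, so its chain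
is increasing. All chains before it are decreasing, hence the constant word `false`. -/
theorem kMarkovNumber_unit (k c : ℕ) :
    kMarkovNumber k ((c + 1 : ℕ) : ℤ) 1 =
      centralForm k (blockState k (fun _ => false) unitLink c) := by
  rw [kMarkovNumber_eq_pair k (2 * c) (unitData c) (fun j => decide (c ≤ j)) unitLink
    (unitData_valid c) (unitData_lt c) (exists_unitData_seg_eq c)
    (unitData_closerToRight c) (fun j _ => exists_unitData_isEndpoint c j)
    (unitData_link c), pair_blockState_of_symm k c fun j => decide (c ≤ j)]
  · rw [blockState_congr (chain' := fun _ => false)]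
    · rfl
    · intro j hj
      simpa using hj
  · intro r hr
    rw [decide_eq_true (by omega), decide_eq_false (by omega), Bool.not_false]
  · intro r hr
    rw [unitLink, unitLink, ← decide_not, decide_eq_decide]
    omega
  · simp

/-- The chains of the first half of the fence of the segment from `(0, 0)` to `(n + 1, n)`. -/
def diagHalfChain (j : ℕ) : Bool := decide (j % 4 ≠ 0)

/-- Of the `4 * m + 3` crossings, number `2 * m + 1` is the midpoint. The chains before it follow a
pattern independent of `m`, so all middle states lie on one sequence of block states. -/
theorem kMarkovNumber_diag (k m : ℕ) :
    kMarkovNumber k (((m + 1 : ℕ) : ℤ) + 1) ((m + 1 : ℕ) : ℤ) =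
      centralForm k (blockState k diagHalfChain diagLink (2 * m + 1)) := by
  rw [kMarkovNumber_eq_pair k (2 * (2 * m + 1)) (diagData m) (diagChain m) diagLink
    (fun j hj => diagData_valid m j (by omega)) (fun j hj => diagData_lt m j (by omega))
    (fun d => by simpa only [show 2 * (2 * m + 1) = 4 * m + 2 by ring] using
      exists_diagData_seg_eq m d)
    (fun j hj => diagData_closerToRight m j (by omega))
    (fun j _ => exists_diagData_isEndpoint m j)
    (fun j hj => diagData_link m j (by omega)), pair_blockState_of_symm]
  · rw [blockState_congr (chain' := diagHalfChain)]
    · rfl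
    · intro j hj
      rw [diagChain, diagHalfChain, decide_eq_decide]
      omega
  · intro r hr
    rw [diagChain, diagChain, ← decide_not, decide_eq_decide]
    omega
  · intro r hr
    rw [diagLink, diagLink, ← decide_not, decide_eq_decide]
    omega
  · rw [diagChain, decide_eq_true_eq]
    omega

/-! ### Invariant quadratic forms and the recurrences -/

section Recurrence

lemma centralForm_cast (k : ℕ) (v : ℕ × ℕ) :
    (centralForm k v : ℝ) = (v.1 : ℝ) ^ 2 + (v.2 : ℝ) ^ 2 + k * (v.1 * v.2) := by
  simp [centralForm]

lemma unitState_odd (k a : ℕ) (x y : ℕ)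
    (h : blockState k (fun _ => false) unitLink (2 * a) = (x, y)) :
    blockState k (fun _ => false) unitLink (2 * a + 1) = (x + (k + 1) * y, y) := by
  have hl : unitLink (2 * a) = false := by simp [unitLink]
  rw [blockState, h, hl, step_false_iterate, step]
  ext <;> simp
  ring

lemma unitState_even (k a : ℕ) (x y : ℕ)
    (h : blockState k (fun _ => false) unitLink (2 * a + 1) = (x, y)) :
    blockState k (fun _ => false) unitLink (2 * (a + 1)) = (x + k * y, x + (k + 1) * y) := by
  have hl : unitLink (2 * a + 1) = true := by simp [unitLink, Nat.add_mod]
  rw [show 2 * (a + 1) = 2 * a + 1 + 1 by ring, blockState, h, hl, step_false_iterate, step]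
  ext <;> simp
  ring

/-- Two blocks act by `M = [[1, 2k + 1], [1, 2k + 2]]`, of determinant 1 and trace `2k + 3`. The
form is `det (v, M v)`, which `M` preserves; it equals 1 at the initial state `(1, 1)`. -/
lemma exists_unitState (k a : ℕ) : ∃ x y : ℕ,
    blockState k (fun _ => false) unitLink (2 * a) = (x, y) ∧
      (x : ℝ) ^ 2 + (2 * k + 1) * (x * y) - (2 * k + 1) * (y : ℝ) ^ 2 = 1 := by
  induction a with
  | zero => exact ⟨1, 1, rfl, by push_cast; ring⟩
  | succ a ih =>
    obtain ⟨x, y, h, hQ⟩ := ih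
    refine ⟨_, _, unitState_even k a _ _ (unitState_odd k a _ _ h), ?_⟩
    push_cast
    linear_combination hQ

/-- As polynomials in `x` and `y`, the second-order expression in the central forms is `-k` times
the invariant form, for either parity of `c`. -/
lemma centralForm_unitState_recurrence (k c : ℕ) :
    (centralForm k (blockState k (fun _ => false) unitLink (c + 2)) : ℝ) =
      (2 * k + 3) * centralForm k (blockState k (fun _ => false) unitLink (c + 1)) -
        centralForm k (blockState k (fun _ => false) unitLink c) - k := by
  obtain ⟨a, rfl | rfl⟩ := Nat.even_or_odd' c
  · obtain ⟨x, y, h, hQ⟩ := exists_unitState k a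
    have h1 := unitState_odd k a _ _ h
    have h2 := unitState_even k a _ _ h1
    rw [show 2 * a + 2 = 2 * (a + 1) by ring, h, h1, h2]
    simp only [centralForm_cast]
    push_cast
    linear_combination (-k : ℝ) * hQ
  · obtain ⟨x, y, h, hQ⟩ := exists_unitState k a
    have h1 := unitState_odd k a _ _ h
    have h2 := unitState_even k a _ _ h1
    have h3 := unitState_odd k (a + 1) _ _ h2
    rw [show 2 * a + 1 + 2 = 2 * (a + 1) + 1 by ring, show 2 * a + 1 + 1 = 2 * (a + 1) by ring,
      h1, h2, h3]
    simp only [centralForm_cast]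
    push_cast
    linear_combination (-k : ℝ) * hQ

lemma diagState_three (k b : ℕ) (x y : ℕ)
    (h : blockState k diagHalfChain diagLink (4 * b + 1) = (x, y)) :
    blockState k diagHalfChain diagLink (4 * b + 3) = (x, 2 * (k + 1) * x + y) := by
  have hl : diagLink (4 * b + 1) = true := by simp [diagLink, Nat.add_mod]
  have hl' : diagLink (4 * b + 2) = true := by simp [diagLink, Nat.add_mod]
  have hc : diagHalfChain (4 * b + 1) = true := by simp [diagHalfChain, Nat.add_mod]
  have hc' : diagHalfChain (4 * b + 2) = true := by simp [diagHalfChain, Nat.add_mod]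
  rw [blockState, blockState, h, hl, hl', hc, hc', step_true_iterate, step, step_true_iterate,
    step]
  ext <;> simp
  ring

lemma diagState_one (k b : ℕ) (x y : ℕ)
    (h : blockState k diagHalfChain diagLink (4 * b + 3) = (x, y)) :
    blockState k diagHalfChain diagLink (4 * (b + 1) + 1) =
      (x + (k + 2) * (k * x + y), k * x + y) := by
  have hl : diagLink (4 * b + 3) = false := by simp [diagLink, Nat.add_mod]
  have hl' : diagLink (4 * (b + 1)) = false := by simp [diagLink]
  have hc : diagHalfChain (4 * b + 3) = true := by simp [diagHalfChain, Nat.add_mod]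
  have hc' : diagHalfChain (4 * (b + 1)) = false := by simp [diagHalfChain]
  rw [blockState, hl', hc', show 4 * (b + 1) = 4 * b + 3 + 1 by ring, blockState, h, hl, hc,
    step_true_iterate, step, step_false_iterate, step]
  ext <;> simp
  ring

lemma diagState_zero (k : ℕ) :
    blockState k diagHalfChain diagLink 1 = (k + 2, 1) := by
  have hl : diagLink 0 = false := by simp [diagLink]
  have hc : diagHalfChain 0 = false := by simp [diagHalfChain]
  rw [blockState, blockState, hl, hc, step_false_iterate, step]
  ext <;> simp
  ring

/-- Four blocks act by `M = [[1 + (k + 2)(3k + 2), k + 2], [3k + 2, 1]]`, of determinant 1 and trace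
`3k² + 8k + 6`. The form is again `det (v, M v)`, evaluated at the starting state `(k + 2, 1)`. -/
lemma exists_diagState (k b : ℕ) : ∃ x y : ℕ,
    blockState k diagHalfChain diagLink (4 * b + 1) = (x, y) ∧
      (3 * k + 2) * (x : ℝ) ^ 2 - (k + 2) * (3 * k + 2) * (x * y) - (k + 2) * (y : ℝ) ^ 2 =
        -(k + 2) := by
  induction b with
  | zero => exact ⟨_, _, diagState_zero k, by push_cast; ring⟩
  | succ b ih =>
    obtain ⟨x, y, h, hQ⟩ := ih
    refine ⟨_, _, diagState_one k b _ _ (diagState_three k b _ _ h), ?_⟩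
    push_cast
    linear_combination hQ

/-- Here the second-order expression is `k` times the invariant form, whose value `-(k + 2)` gives
the constant `-k(k + 2)`. -/
lemma centralForm_diagState_recurrence (k m : ℕ) :
    (centralForm k (blockState k diagHalfChain diagLink (2 * (m + 2) + 1)) : ℝ) =
      (3 * (k : ℝ) ^ 2 + 8 * k + 6) *
          centralForm k (blockState k diagHalfChain diagLink (2 * (m + 1) + 1)) -
        centralForm k (blockState k diagHalfChain diagLink (2 * m + 1)) - k * (k + 2) := by
  obtain ⟨b, rfl | rfl⟩ := Nat.even_or_odd' m
  · obtain ⟨x, y, h, hQ⟩ := exists_diagState k b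
    have h1 := diagState_three k b _ _ h
    have h2 := diagState_one k b _ _ h1
    rw [show 2 * (2 * b + 2) + 1 = 4 * (b + 1) + 1 by ring,
      show 2 * (2 * b + 1) + 1 = 4 * b + 3 by ring, show 2 * (2 * b) + 1 = 4 * b + 1 by ring,
      h, h1, h2]
    simp only [centralForm_cast]
    push_cast
    linear_combination (k : ℝ) * hQ
  · obtain ⟨x, y, h, hQ⟩ := exists_diagState k b
    have h1 := diagState_three k b _ _ h
    have h2 := diagState_one k b _ _ h1
    have h3 := diagState_three k (b + 1) _ _ h2
    rw [show 2 * (2 * b + 1 + 2) + 1 = 4 * (b + 1) + 3 by ring,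
      show 2 * (2 * b + 1 + 1) + 1 = 4 * (b + 1) + 1 by ring,
      show 2 * (2 * b + 1) + 1 = 4 * b + 3 by ring, h1, h2, h3]
    simp only [centralForm_cast]
    push_cast
    linear_combination (k : ℝ) * hQ

end Recurrence

/-! ### Closed forms, asymptotics and initial values -/

lemma eq_of_linear_recurrence {u : ℕ → ℝ} {T κ e a b x y : ℝ}
    (hu : ∀ n, u (n + 2) = T * u (n + 1) - u n - κ) (he : e = T * e - e - κ)
    (hx : x ^ 2 = T * x - 1) (hy : y ^ 2 = T * y - 1) (h0 : u 0 = e + a + b)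
    (h1 : u 1 = e + a * x + b * y) (n : ℕ) : u n = e + a * x ^ n + b * y ^ n := by
  induction n using Nat.twoStepInduction with
  | zero => simpa using h0
  | one => simpa using h1
  | more n ih1 ih2 =>
    rw [hu, ih1, ih2]
    linear_combination -he - a * x ^ n * hx - b * y ^ n * hy

/-- The quotient is `1 + (e / a) * x⁻¹ ^ n + (b / a) * (y / x) ^ n`, and both powers tend to 0. -/
lemma tendsto_div_of_dominant {u : ℕ → ℝ} {e a b x y : ℝ} (ha : a ≠ 0) (hx : 1 < x)
    (hy : |y| < x) (hu : ∀ n, u n = e + a * x ^ n + b * y ^ n) :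
    Tendsto (fun n => u n / (a * x ^ n)) atTop (𝓝 1) := by
  have hx0 : 0 < x := by linarith
  have h1 : Tendsto (fun n : ℕ => (x⁻¹) ^ n) atTop (𝓝 0) :=
    tendsto_pow_atTop_nhds_zero_of_lt_one (by positivity) (inv_lt_one_of_one_lt₀ hx)
  have h2 : Tendsto (fun n : ℕ => (y / x) ^ n) atTop (𝓝 0) := by
    apply tendsto_pow_atTop_nhds_zero_of_abs_lt_one
    rw [abs_div, abs_of_pos hx0, div_lt_one hx0]
    exact hy
  have h3 := ((h1.const_mul (e / a)).add (h2.const_mul (b / a))).const_add 1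
  simp only [mul_zero, add_zero] at h3
  refine h3.congr fun n => ?_
  have hxn : x ^ n ≠ 0 := pow_ne_zero n hx0.ne'
  rw [hu, inv_pow, div_pow]
  field_simp
  ring

lemma unit_sequence (k : ℕ) (f : ℕ → ℝ) (hf : ∀ n : ℕ, f n = (kMarkovNumber k (n : ℤ) 1 : ℝ)) :
    f 0 = 1 ∧ f 1 = k + 2 ∧ ∀ n, f (n + 2) = (2 * k + 3) * f (n + 1) - f n - k := by
  have h0 : f 0 = 1 := by
    rw [hf, Nat.cast_zero, kMarkovNumber_eq_one k isEmpty_crossing_zero_one, Nat.cast_one]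
  have hs : ∀ c, f (c + 1) = centralForm k (blockState k (fun _ => false) unitLink c) := fun c => by
    rw [hf, kMarkovNumber_unit]
  have h1 : f 1 = k + 2 := by
    rw [hs 0, centralForm_cast, blockState]
    push_cast
    ring
  refine ⟨h0, h1, fun n => ?_⟩
  cases n with
  | zero =>
    -- The value `f 0` comes from an empty fence and is not a central form, so the first instance of
    -- the recurrence is checked directly.
    rw [zero_add, zero_add, h0, h1, hs 1, centralForm_cast, unitState_odd k 0 1 1 rfl]
    push_cast
    ring
  | succ n =>
    rw [hs, hs, hs]
    exact centralForm_unitState_recurrence k n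

lemma diag_sequence (k : ℕ) (g : ℕ → ℝ)
    (hg : ∀ n : ℕ, g n = (kMarkovNumber k ((n : ℤ) + 1) (n : ℤ) : ℝ)) :
    g 0 = 1 ∧ g 1 = 2 * (k : ℝ) ^ 2 + 6 * k + 5 ∧
      ∀ n, g (n + 2) =
        (3 * (k : ℝ) ^ 2 + 8 * k + 6) * g (n + 1) - g n - k * (k + 2) := by
  have h0 : g 0 = 1 := by
    rw [hg, Nat.cast_zero, zero_add, kMarkovNumber_eq_one k isEmpty_crossing_one_zero,
      Nat.cast_one]
  have hs : ∀ m, g (m + 1) =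
      centralForm k (blockState k diagHalfChain diagLink (2 * m + 1)) := fun m => by
    rw [hg, kMarkovNumber_diag]
  have h1 : g 1 = 2 * (k : ℝ) ^ 2 + 6 * k + 5 := by
    rw [hs 0, centralForm_cast, mul_zero, zero_add, diagState_zero]
    push_cast
    ring
  refine ⟨h0, h1, fun n => ?_⟩
  cases n with
  | zero =>
    rw [zero_add, zero_add, h0, h1, hs 1, centralForm_cast,
      diagState_three k 0 _ _ (diagState_zero k)]
    push_cast
    ring
  | succ n =>
    rw [hs, hs, hs]
    exact centralForm_diagState_recurrence k n

lemma sq_eq_of_sqrt {T r : ℝ} (hr : r ^ 2 = T ^ 2 - 4) :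
    ((T + r) / 2) ^ 2 = T * ((T + r) / 2) - 1 ∧ ((T - r) / 2) ^ 2 = T * ((T - r) / 2) - 1 :=
  ⟨by linear_combination hr / 4, by linear_combination hr / 4⟩

lemma abs_sub_div_two_lt {T r : ℝ} (hT : 0 < T) (hr : 0 < r) : |(T - r) / 2| < (T + r) / 2 :=
  abs_lt.2 ⟨by linarith, by linarith⟩

end KMarkov

theorem proposition4p1 (k : ℕ) :
    -- the sequence `f n = m^{(k)}_{1/n}`
    (∀ (f : ℕ → ℝ) (_ : ∀ n : ℕ, f n = (kMarkovNumber k (n : ℤ) 1 : ℝ))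
        (α : ℝ) (_ : α = 4 * (k : ℝ) ^ 2 + 12 * k + 5),
      f 0 = 1 ∧ f 1 = k + 2 ∧
      (∀ n : ℕ, 2 ≤ n → f n = (2 * k + 3) * f (n - 1) - f (n - 2) - k) ∧
      (∀ n : ℕ, f n =
        k / (1 + 2 * k)
        + (2 * (k : ℝ) ^ 2 + 3 * k + 1 + (1 + k) * √α) / (2 * (1 + 2 * k) * √α)
            * ((3 + 2 * k + √α) / 2) ^ n
        + (-(2 * (k : ℝ) ^ 2 + 3 * k + 1) + (1 + k) * √α) / (2 * (1 + 2 * k) * √α)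
            * ((3 + 2 * k - √α) / 2) ^ n) ∧
      Tendsto (fun n : ℕ => f n /
          ((2 * (k : ℝ) ^ 2 + 3 * k + 1 + (1 + k) * √α) / (2 * (1 + 2 * k) * √α)
            * ((3 + 2 * k + √α) / 2) ^ n)) atTop (𝓝 1)) ∧
    -- the sequence `g n = m^{(k)}_{n/(n+1)}`
    (∀ (g : ℕ → ℝ) (_ : ∀ n : ℕ, g n = (kMarkovNumber k ((n : ℤ) + 1) (n : ℤ) : ℝ))
        (β δ : ℝ) (_ : β = 3 * (k : ℝ) ^ 2 + 8 * k + 6)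
        (_ : δ = 3 * (k : ℝ) ^ 4 + 17 * (k : ℝ) ^ 3 + 34 * (k : ℝ) ^ 2 + 28 * k + 8),
      g 0 = 1 ∧ g 1 = 2 * (k : ℝ) ^ 2 + 6 * k + 5 ∧
      (∀ n : ℕ, 2 ≤ n →
        g n = (3 * (k : ℝ) ^ 2 + 8 * k + 6) * g (n - 1) - g (n - 2) - k * (k + 2)) ∧
      (∀ n : ℕ, g n =
        k / (3 * k + 2)
        + ((k + 1) * (k + 2) * (β ^ 2 - 4) + δ * √(β ^ 2 - 4)) / ((β - 2) * (β ^ 2 - 4))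
            * ((β + √(β ^ 2 - 4)) / 2) ^ n
        + ((k + 1) * (k + 2) * (β ^ 2 - 4) - δ * √(β ^ 2 - 4)) / ((β - 2) * (β ^ 2 - 4))
            * ((β - √(β ^ 2 - 4)) / 2) ^ n) ∧
      Tendsto (fun n : ℕ => g n /
          (((k + 1) * (k + 2) * (β ^ 2 - 4) + δ * √(β ^ 2 - 4)) / ((β - 2) * (β ^ 2 - 4))
            * ((β + √(β ^ 2 - 4)) / 2) ^ n)) atTop (𝓝 1)) := by
  have hk : (0 : ℝ) ≤ k := Nat.cast_nonneg k
  constructor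
  · rintro f hf α rfl
    obtain ⟨h0, h1, hrec⟩ := KMarkov.unit_sequence k f hf
    set r := √(4 * (k : ℝ) ^ 2 + 12 * k + 5) with hr
    have hr0 : 0 < r := Real.sqrt_pos.2 (by positivity)
    -- `α` is the discriminant of the characteristic polynomial `X² - (2k + 3) X + 1`.
    have hr2 : r ^ 2 = (3 + 2 * (k : ℝ)) ^ 2 - 4 := by
      rw [hr, Real.sq_sqrt (by positivity)]
      ring
    obtain ⟨hx, hy⟩ := KMarkov.sq_eq_of_sqrt hr2
    have hk1 : 1 + 2 * (k : ℝ) ≠ 0 := by positivity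
    have hclosed := fun n => KMarkov.eq_of_linear_recurrence (u := f) (T := 3 + 2 * k) (κ := k)
      (e := k / (1 + 2 * k))
      (a := (2 * (k : ℝ) ^ 2 + 3 * k + 1 + (1 + k) * r) / (2 * (1 + 2 * k) * r))
      (b := (-(2 * (k : ℝ) ^ 2 + 3 * k + 1) + (1 + k) * r) / (2 * (1 + 2 * k) * r))
      (fun n => by rw [hrec]; ring) (by field_simp; ring) hx hy
      (by rw [h0]; field_simp; ring) (by rw [h1]; field_simp; ring) n
    refine ⟨h0, h1, fun n hn => ?_, hclosed, ?_⟩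
    · obtain ⟨m, rfl⟩ := Nat.exists_eq_add_of_le' hn
      exact hrec m
    · exact KMarkov.tendsto_div_of_dominant (by positivity) (by linarith)
        (KMarkov.abs_sub_div_two_lt (by positivity) hr0) hclosed
  · rintro g hg β δ hβ hδ
    obtain ⟨h0, h1, hrec⟩ := KMarkov.diag_sequence k g hg
    -- The constant solution is `k(k + 2) / (β - 2)`; this factorization reduces it to `k / (3k +
    -- 2)`.
    have hβ2 : β - 2 = (3 * k + 2) * (k + 2) := by rw [hβ]; ring
    have hβ0 : 6 ≤ β := by rw [hβ]; nlinarith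
    have hδ0 : 0 < δ := by rw [hδ]; positivity
    have hpos : 0 < β ^ 2 - 4 := by nlinarith
    set r := √(β ^ 2 - 4) with hr
    have hr0 : 0 < r := Real.sqrt_pos.2 hpos
    have hr2 : r ^ 2 = β ^ 2 - 4 := Real.sq_sqrt hpos.le
    obtain ⟨hx, hy⟩ := KMarkov.sq_eq_of_sqrt hr2
    rw [← hr2, hβ2]
    have hk1 : 3 * (k : ℝ) + 2 ≠ 0 := by positivity
    have hk2 : (k : ℝ) + 2 ≠ 0 := by positivity
    have hclosed := fun n => KMarkov.eq_of_linear_recurrence (u := g) (T := β) (κ := k * (k + 2))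
      (e := k / (3 * k + 2))
      (a := ((k + 1) * (k + 2) * r ^ 2 + δ * r) / ((3 * k + 2) * (k + 2) * r ^ 2))
      (b := ((k + 1) * (k + 2) * r ^ 2 - δ * r) / ((3 * k + 2) * (k + 2) * r ^ 2))
      (fun n => by rw [hrec, hβ]) (by rw [hβ]; field_simp; ring) hx hy
      (by rw [h0]; field_simp; ring) (by rw [h1]; field_simp; rw [hδ, hβ]; ring) n
    refine ⟨h0, h1, fun n hn => ?_, hclosed, ?_⟩
    · obtain ⟨m, rfl⟩ := Nat.exists_eq_add_of_le' hn
      exact hrec m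
    · exact KMarkov.tendsto_div_of_dominant (by positivity) (by linarith)
        (KMarkov.abs_sub_div_two_lt (by linarith) hr0) hclosed
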